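/- Let $H$ be a separable infinite-dimensional complex Hilbert space and let $\mathcal{B}(H)$ be the space of bounded linear operators on $H$ with the operator norm topology. For $T\in\mathcal{B}(H)$ let $\sigma(T)$ be the spectrum of $T$, let $\sigma_p(T)=\{\lambda\in\mathbb{C} : \ker(T-\lambda\,\mathrm{id}_H)\neq\{0\}\}$ be its point spectrum, and let $$\sigma_c(T)=\sigma(T)\setminus\bigl(\sigma_p(T)\cup\{\bar\lambda : \lambda\in\sigma_p(T^*)\}\bigr)$$ be its continuous spectrum. Then the set $$\{T\in\mathcal{B}(H) : \sigma_c(T)\neq\emptyset\}$$ is co-meager in $\mathcal{B}(H)$, i.e. it contains a dense $G_\delta$ set. Consequently the set $\{T\in\mathcal{B}(H) : \sigma_c(T)=\emptyset\}$ is meager, and in particular it is not co-meager. -/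

import Mathlib

/-- The point spectrum `σ_p(T)`: all `z : ℂ` with `ker (T - z id) ≠ {0}`. -/
def operatorPointSpectrum {H : Type*} [NormedAddCommGroup H] [InnerProductSpace ℂ H]
    (T : H →L[ℂ] H) : Set ℂ :=
  {z : ℂ | LinearMap.ker ((T - z • ContinuousLinearMap.id ℂ H : H →L[ℂ] H) : H →ₗ[ℂ] H) ≠ ⊥}

/-- The continuous spectrum `σ_c(T) = σ(T) \ (σ_p(T) ∪ conj σ_p(T*))`, where `conj` is
elementwise complex conjugation. -/
def operatorContinuousSpectrum {H : Type*} [NormedAddCommGroup H] [InnerProductSpace ℂ H]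
    [CompleteSpace H] (T : H →L[ℂ] H) : Set ℂ :=
  spectrum ℂ T \ (operatorPointSpectrum T ∪
    (starRingEnd ℂ) '' operatorPointSpectrum (ContinuousLinearMap.adjoint T))

universe u

section Genericity

open Filter Set Topology

/-! ### Baire category -/

/-- A Borel function into a second countable space is continuous on a residual set. -/
theorem Measurable.exists_mem_residual_continuousOn {X Y : Type*} [TopologicalSpace X]
    [MeasurableSpace X] [BorelSpace X] [TopologicalSpace Y] [SecondCountableTopology Y]
    [MeasurableSpace Y] [OpensMeasurableSpace Y] {f : X → Y} (hf : Measurable f) :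
    ∃ D ∈ residual X, ContinuousOn f D := by
  obtain ⟨B, hBc, -, hB⟩ := TopologicalSpace.exists_countable_basis Y
  have key : ∀ b : B, ∃ u : Set X, IsOpen u ∧ f ⁻¹' b =ᶠ[residual X] u := fun b =>
    (hf (hB.isOpen b.2).measurableSet).residualEq_isOpen
  choose u hu hfu using key
  have : Countable B := hBc.to_subtype
  refine ⟨{x | ∀ b : B, (f ⁻¹' b) x = u b x}, eventually_countable_forall.2 hfu, ?_⟩
  intro x hx
  rw [ContinuousWithinAt, hB.nhds_hasBasis.tendsto_right_iff]
  rintro b ⟨hb, hxb⟩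
  have hxu : x ∈ u ⟨b, hb⟩ := (hx ⟨b, hb⟩).mp hxb
  filter_upwards [mem_nhdsWithin_of_mem_nhds ((hu _).mem_nhds hxu), self_mem_nhdsWithin]
    with y hyu hyD
  exact (hyD ⟨b, hb⟩).mpr hyu

/-- A relatively open and relatively dense subset of a residual set is residual. -/
theorem mem_residual_of_mem_nhdsWithin_of_subset_closure {X : Type*} [TopologicalSpace X]
    [BaireSpace X] {D W : Set X} (hD : D ∈ residual X) (hW : ∀ x ∈ W, W ∈ 𝓝[D] x)
    (h : D ⊆ closure W) : W ∈ residual X := by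
  -- The interior of `D → W` is an open set that meets `D` only inside `W`.
  have hsub : W ⊆ interior {x | x ∈ D → x ∈ W} := fun x hx =>
    mem_interior_iff_mem_nhds.2 (mem_nhdsWithin_iff_eventually.1 (hW x hx))
  have hdense : Dense W := dense_closure.1 ((dense_of_mem_residual hD).mono h)
  filter_upwards [residual_of_dense_open isOpen_interior (hdense.mono hsub), hD] with x hx hxD
  exact interior_subset hx hxD

/-! ### A generically continuous choice of boundary spectral value -/

/-- At a boundary point of the spectrum there is neither a left nor a right inverse. -/
theorem spectrum.no_one_sided_inverse_of_mem_frontier {A : Type*} [NormedRing A] [NormedAlgebra ℂ A]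
    [CompleteSpace A] {a b : A} {z : ℂ} (hz : z ∈ frontier (spectrum ℂ a)) :
    b * (algebraMap ℂ A z - a) ≠ 1 ∧ (algebraMap ℂ A z - a) * b ≠ 1 := by
  have hmem : z ∈ spectrum ℂ a := (spectrum.isClosed a).frontier_subset hz
  have hcl : z ∈ closure (spectrum ℂ a)ᶜ := (frontier_eq_closure_inter_closure.subset hz).2
  -- Units form an open set, so the product stays invertible at some nearby `w` in the resolvent
  -- set; this forces `b` to be a unit.
  have aux : ∀ g : ℂ → A, Continuous g → g z = 1 → ∃ w, w ∉ spectrum ℂ a ∧ IsUnit (g w) := by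
    intro g hg hgz
    have : ∀ᶠ w in 𝓝 z, IsUnit (g w) :=
      hg.continuousAt.eventually (Units.isOpen.mem_nhds (by simp [hgz]))
    obtain ⟨w, hw, hw'⟩ := (mem_closure_iff_frequently.1 hcl).and_eventually this |>.exists
    exact ⟨w, hw, hw'⟩
  constructor <;> intro h
  · obtain ⟨w, hw, hu⟩ := aux (fun w => b * (algebraMap ℂ A w - a)) (by fun_prop) h
    rw [spectrum.notMem_iff] at hw
    obtain ⟨u, rfl⟩ : IsUnit b := (Units.isUnit_mul_units b hw.unit).1 hu
    exact hmem ⟨u⁻¹, Units.inv_eq_of_mul_eq_one_right h⟩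
  · obtain ⟨w, hw, hu⟩ := aux (fun w => (algebraMap ℂ A w - a) * b) (by fun_prop) h
    rw [spectrum.notMem_iff] at hw
    obtain ⟨u, rfl⟩ : IsUnit b := (Units.isUnit_units_mul hw.unit b).1 hu
    exact hmem ⟨u⁻¹, Units.inv_eq_of_mul_eq_one_left h⟩

/-- The set of elements whose spectrum meets a given closed set is closed. -/
theorem spectrum.isClosed_setOf_inter_nonempty {A : Type*} [NormedRing A] [NormedAlgebra ℂ A]
    [CompleteSpace A] {s : Set ℂ} (hs : IsClosed s) :
    IsClosed {a : A | (spectrum ℂ a ∩ s).Nonempty} := by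
  have := upperHemicontinuous_iff_isOpen_preimage_Iic.1 (upperHemicontinuous_spectrum ℂ A) _
    hs.isOpen_compl
  rw [← isOpen_compl_iff]
  convert this using 1
  ext a
  simp [Set.not_nonempty_iff_eq_empty, ← disjoint_iff_inter_eq_empty,
    subset_compl_iff_disjoint_right]

/-- The spectrum has a greatest point for the lexicographic order on real and imaginary parts. -/
theorem spectrum.exists_lex_max {A : Type*} [NormedRing A] [NormedAlgebra ℂ A]
    [CompleteSpace A] [Nontrivial A] (a : A) : ∃ z ∈ spectrum ℂ a,
      (∀ w ∈ spectrum ℂ a, w.re ≤ z.re) ∧ ∀ w ∈ spectrum ℂ a, w.re = z.re → w.im ≤ z.im := by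
  have hc := spectrum.isCompact (𝕜 := ℂ) a
  obtain ⟨x, hx, hmax⟩ := hc.exists_isMaxOn (spectrum.nonempty a) Complex.continuous_re.continuousOn
  have hc' : IsCompact (spectrum ℂ a ∩ {w | w.re = x.re}) :=
    hc.inter_right (isClosed_eq Complex.continuous_re continuous_const)
  obtain ⟨z, hz, hzmax⟩ := hc'.exists_isMaxOn ⟨x, hx, rfl⟩ Complex.continuous_im.continuousOn
  have hzx : z.re = x.re := hz.2
  refine ⟨z, hz.1, fun w hw => hzx ▸ hmax hw, fun w hw hwz => hzmax ⟨hw, ?_⟩⟩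
  simpa [hzx] using hwz

/-- The spectrum of an element of a complex Banach algebra has a boundary point that can be chosen
continuously on a residual set. -/
theorem spectrum.exists_residual_continuousOn_selection (A : Type*) [NormedRing A]
    [NormedAlgebra ℂ A] [CompleteSpace A] [Nontrivial A] :
    ∃ f : A → ℂ, (∀ a, f a ∈ frontier (spectrum ℂ a)) ∧
      ∃ D ∈ residual A, ContinuousOn f D := by
  choose f hf hre him using spectrum.exists_lex_max (A := A)
  let _ : MeasurableSpace A := borel A
  have : BorelSpace A := ⟨rfl⟩
  have hmre : Measurable fun a => (f a).re := by
    refine measurable_of_Ici fun p => ?_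
    convert (spectrum.isClosed_setOf_inter_nonempty (A := A)
      (isClosed_le continuous_const Complex.continuous_re : IsClosed {z : ℂ | p ≤ z.re})).measurableSet
    ext a
    exact ⟨fun h => ⟨f a, hf a, h⟩, fun ⟨w, hw, h⟩ => le_trans h (hre a w hw)⟩
  have hmim : Measurable fun a => (f a).im := by
    refine measurable_of_Ici fun q => ?_
    -- Rational `p` below `(f a).re` keep the intersection countable; compactness recovers a
    -- spectral point with maximal real part and imaginary part at least `q`.
    have hset : (fun a => (f a).im) ⁻¹' Ici q = ⋂ p : ℚ, ({a | (p : ℝ) ≤ (f a).re}ᶜ ∪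
        {a | (spectrum ℂ a ∩ {z | (p : ℝ) ≤ z.re ∧ q ≤ z.im}).Nonempty}) := by
      ext a
      simp only [mem_preimage, mem_Ici, mem_iInter, mem_union, mem_compl_iff]
      constructor
      · intro h p
        by_cases hp : (p : ℝ) ≤ (f a).re
        · exact .inr ⟨f a, hf a, hp, h⟩
        · exact .inl hp
      · intro h
        have hc : IsCompact (spectrum ℂ a ∩ {w | q ≤ w.im}) :=
          (spectrum.isCompact a).inter_right (isClosed_le continuous_const Complex.continuous_im)
        have hex : ∀ p : ℚ, (p : ℝ) ≤ (f a).re →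
            (spectrum ℂ a ∩ {z | (p : ℝ) ≤ z.re ∧ q ≤ z.im}).Nonempty :=
          fun p hp => (h p).resolve_left fun h' => h' hp
        obtain ⟨p₀, hp₀⟩ := exists_rat_lt (f a).re
        obtain ⟨w₀, hw₀, -, hw₀q⟩ := hex p₀ hp₀.le
        obtain ⟨z, hz, hzmax⟩ := hc.exists_isMaxOn ⟨w₀, hw₀, hw₀q⟩ Complex.continuous_re.continuousOn
        have hzre : (f a).re ≤ z.re := by
          by_contra! hlt
          obtain ⟨p, hp, hp'⟩ := exists_rat_btwn hlt
          obtain ⟨w, hw, hwp, hwq⟩ := hex p hp'.le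
          exact absurd (hzmax (show w ∈ _ from ⟨hw, hwq⟩)) (by simpa using hp.trans_le hwp)
        exact le_trans hz.2 (him a z hz.1 (le_antisymm (hre a z hz.1) hzre))
    rw [hset]
    refine .iInter fun p => .union (measurableSet_le measurable_const hmre).compl ?_
    exact (spectrum.isClosed_setOf_inter_nonempty ((isClosed_le continuous_const
      Complex.continuous_re).inter (isClosed_le continuous_const Complex.continuous_im))).measurableSet
  have hm : Measurable f := measurable_of_re_im hmre hmim
  refine ⟨f, fun a => ?_, hm.exists_mem_residual_continuousOn⟩
  refine ⟨subset_closure (hf a), fun hint => ?_⟩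
  -- Moving right from a point of maximal real part leaves the spectrum.
  have ht : Tendsto (fun t : ℝ => f a + t) (𝓝[>] 0) (𝓝 (f a)) := by
    have : Continuous (fun t : ℝ => f a + t) := by fun_prop
    simpa using (this.tendsto 0).mono_left nhdsWithin_le_nhds
  obtain ⟨t, ht, ht0⟩ := ((ht.eventually (mem_interior_iff_mem_nhds.1 hint)).and
    self_mem_nhdsWithin).exists
  have := hre a _ ht
  simp at this ht0
  linarith

/-! ### The Calkin algebra -/

/-- The normed ring structure on the quotient of a normed ring by a closed two-sided ideal. -/
noncomputable abbrev Ideal.Quotient.normedRingOfIsClosed {R : Type*} [NormedRing R] (I : Ideal R)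
    [I.IsTwoSided] (hI : IsClosed (I : Set R)) : NormedRing (R ⧸ I) :=
  haveI := hI
  { Submodule.Quotient.normedAddCommGroup I, Ideal.Quotient.ring I with
    norm_mul_le := fun x y => by
      have hlim : Tendsto (fun ε : ℝ => (‖x‖ + ε) * (‖y‖ + ε)) (𝓝[>] 0) (𝓝 (‖x‖ * ‖y‖)) := by
        have : Continuous fun ε : ℝ => (‖x‖ + ε) * (‖y‖ + ε) := by fun_prop
        simpa using (this.tendsto 0).mono_left nhdsWithin_le_nhds
      refine ge_of_tendsto hlim ?_
      filter_upwards [self_mem_nhdsWithin] with ε hε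
      obtain ⟨a, rfl, ha⟩ := Submodule.Quotient.norm_mk_lt x hε
      obtain ⟨b, rfl, hb⟩ := Submodule.Quotient.norm_mk_lt y hε
      calc _ ≤ ‖a * b‖ := Submodule.Quotient.norm_mk_le I (a * b)
        _ ≤ ‖a‖ * ‖b‖ := norm_mul_le a b
        _ ≤ _ := mul_le_mul ha.le hb.le (norm_nonneg _) ((norm_nonneg a).trans ha.le) }

/-- The compact operators as an ideal of the bounded operators. -/
def compactOperatorIdeal (H : Type*) [NormedAddCommGroup H] [NormedSpace ℂ H] :
    Ideal (H →L[ℂ] H) where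
  carrier := {K | IsCompactOperator K}
  add_mem' h h' := h.add h'
  zero_mem' := isCompactOperator_zero
  smul_mem' T _ h := h.clm_comp T

/-- The Calkin algebra, through its characteristic properties. -/
theorem exists_calkin_quotient {H : Type u} [NormedAddCommGroup H] [NormedSpace ℂ H]
    [CompleteSpace H] (hdim : ¬ FiniteDimensional ℂ H) :
    ∃ (C : Type u) (_ : NormedRing C) (_ : NormedAlgebra ℂ C) (_ : CompleteSpace C)
      (_ : Nontrivial C) (π : (H →L[ℂ] H) →ₐ[ℂ] C), Continuous π ∧ IsOpenMap π ∧
      ∀ K : H →L[ℂ] H, IsCompactOperator K → π K = 0 := by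
  let I := compactOperatorIdeal H
  have : I.IsTwoSided := ⟨fun T h => IsCompactOperator.comp_clm h T⟩
  have hI : IsClosed (I : Set (H →L[ℂ] H)) := isClosed_setOfPred_isCompactOperator
  let := Ideal.Quotient.normedRingOfIsClosed I hI
  let : NormedAlgebra ℂ ((H →L[ℂ] H) ⧸ I) :=
    { Ideal.Quotient.algebra ℂ with norm_smul_le := (Submodule.Quotient.normedSpace I ℂ).norm_smul_le }
  refine ⟨(H →L[ℂ] H) ⧸ I, inferInstance, inferInstance, Submodule.Quotient.completeSpace I,
    Ideal.Quotient.nontrivial_iff.2 ?_, Ideal.Quotient.mkₐ ℂ I, ?_, ?_, ?_⟩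
  · intro h
    have h1 : (1 : H →L[ℂ] H) ∈ I := (Ideal.eq_top_iff_one _).1 h
    exact hdim (FiniteDimensional.of_isCompactOperator_id h1)
  · exact (Submodule.isOpenQuotientMap_mkQ I).continuous
  · exact (Submodule.isOpenQuotientMap_mkQ I).isOpenMap
  · exact fun K hK => Ideal.Quotient.eq_zero_iff_mem.2 hK

theorem isCompactOperator_rankOne {H : Type*} [NormedAddCommGroup H]
    [InnerProductSpace ℂ H] (x y : H) : IsCompactOperator (InnerProductSpace.rankOne ℂ x y) :=
  (isCompactOperator_of_locallyCompactSpace_rng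
    (ContinuousLinearMap.toSpanSingleton ℂ x)).comp_clm (innerSL ℂ y)

/-! ### Dense range by rank-one perturbation -/

section GenericRange

open ContinuousLinearMap

variable {H : Type*} [NormedAddCommGroup H] [InnerProductSpace ℂ H] [CompleteSpace H]

/-- An operator without left inverse is not bounded below. -/
theorem exists_norm_apply_lt_of_no_left_inverse {A : H →L[ℂ] H}
    (h : ∀ B : H →L[ℂ] H, B * A ≠ 1) {ε : ℝ} (hε : 0 < ε) : ∃ x : H, ‖x‖ = 1 ∧ ‖A x‖ < ε := by
  by_contra! hA
  have hbd : ∀ x, ε * ‖x‖ ≤ ‖A x‖ := by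
    intro x
    rcases eq_or_ne x 0 with rfl | hx
    · simp
    have hx' : (0 : ℝ) < ‖x‖ := norm_pos_iff.2 hx
    have := hA ((‖x‖⁻¹ : ℂ) • x) (by simp [norm_smul, hx'.ne'])
    rw [map_smul, norm_smul] at this
    simp only [norm_inv, Complex.norm_real, norm_norm] at this
    rwa [inv_mul_eq_div, le_div_iff₀ hx'] at this
  -- If `A` is bounded below, `A*A` is coercive and `(A*A)⁻¹A*` is a left inverse.
  have hu : IsUnit (adjoint A * A) := by
    refine isUnit_of_forall_le_norm_inner_map _ (c := (ε ^ 2).toNNReal)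
      (Real.toNNReal_pos.2 (pow_pos hε 2)) fun x => ?_
    rw [show (adjoint A * A) x = adjoint A (A x) from rfl, adjoint_inner_left,
      inner_self_eq_norm_sq_to_K]
    have := hbd x
    simp only [Real.coe_toNNReal _ (sq_nonneg ε), norm_pow, RCLike.norm_ofReal, abs_norm]
    calc ‖x‖ ^ 2 * ε ^ 2 = (ε * ‖x‖) ^ 2 := by ring
      _ ≤ _ := by gcongr
  obtain ⟨u, hu⟩ := hu
  refine h ((↑u⁻¹ : H →L[ℂ] H) * adjoint A) ?_
  rw [mul_assoc, ← hu, Units.inv_mul]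

/-- A small rank-one perturbation of an operator which is not bounded below has a prescribed vector
in its range. -/
theorem exists_compact_perturbation_mem_range {A : H →L[ℂ] H}
    (h : ∀ ε : ℝ, 0 < ε → ∃ x : H, ‖x‖ = 1 ∧ ‖A x‖ < ε) (e : H) {ε : ℝ} (hε : 0 < ε) :
    ∃ K : H →L[ℂ] H, IsCompactOperator K ∧ IsCompactOperator (adjoint K) ∧ ‖K‖ < ε ∧
      ∃ x, (A + K) x = e := by
  obtain ⟨x, hx, hAx⟩ := h (ε / 2) (by positivity)
  obtain ⟨δ, hδ, hδe⟩ : ∃ δ : ℝ, 0 < δ ∧ δ * ‖e‖ < ε / 2 :=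
    (exists_pos_mul_lt (half_pos hε) ‖e‖).imp fun δ h => ⟨h.1, mul_comm ‖e‖ δ ▸ h.2⟩
  -- As `x` is a unit vector, `K x = δe - A x`, so `(A + K) x = δe`; rescaling by `δ⁻¹` gives `e`.
  refine ⟨InnerProductSpace.rankOne ℂ ((δ : ℂ) • e - A x) x, ?_, ?_, ?_, (δ⁻¹ : ℂ) • x, ?_⟩
  · exact isCompactOperator_rankOne _ _
  · rw [InnerProductSpace.adjoint_rankOne]
    exact isCompactOperator_rankOne _ _
  · rw [InnerProductSpace.norm_rankOne, hx, mul_one]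
    calc _ ≤ ‖(δ : ℂ) • e‖ + ‖A x‖ := norm_sub_le _ _
      _ = δ * ‖e‖ + ‖A x‖ := by rw [norm_smul, Complex.norm_real, Real.norm_of_nonneg hδ.le]
      _ < ε := by linarith
  · have hδ_ne : (δ : ℂ) ≠ 0 := by exact_mod_cast hδ.ne'
    rw [map_smul, add_apply, InnerProductSpace.rankOne_apply, inner_self_eq_norm_sq_to_K, hx]
    simp only [RCLike.ofReal_one, one_pow, one_smul, add_sub_cancel, smul_smul,
      inv_mul_cancel₀ hδ_ne]

/-- If `G` is continuous on a residual set and every vector is in the range of `G T'` for `T'`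
arbitrarily close to `T`, then `G T` generically has dense range. -/
theorem eventually_residual_denseRange [TopologicalSpace.SeparableSpace H]
    {E : Set (H →L[ℂ] H)} (hE : E ∈ residual (H →L[ℂ] H)) {G : (H →L[ℂ] H) → H →L[ℂ] H}
    (hG : ContinuousOn G E)
    (h : ∀ T ∈ E, ∀ (e : H) (ε : ℝ), 0 < ε → ∃ S ∈ E, ‖S - T‖ < ε ∧ ∃ x, G S x = e) :
    ∀ᶠ T in residual (H →L[ℂ] H), DenseRange (G T) := by
  have key : ∀ (e : H) (n : ℕ), ∀ᶠ T in residual (H →L[ℂ] H),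
      ∃ x, ‖G T x - e‖ < 1 / ((n : ℝ) + 1) := by
    intro e n
    have hW : {T | T ∈ E ∧ ∃ x, ‖G T x - e‖ < 1 / ((n : ℝ) + 1)} ∈ residual (H →L[ℂ] H) := by
      refine mem_residual_of_mem_nhdsWithin_of_subset_closure hE ?_ ?_
      · rintro T ⟨hT, x, hx⟩
        have hc : ContinuousWithinAt (fun S => ‖G S x - e‖) E T :=
          (((ContinuousLinearMap.apply ℂ H x).continuous.continuousAt.comp_continuousWithinAt
            (hG T hT)).sub continuousWithinAt_const).norm
        filter_upwards [hc.eventually_lt continuousWithinAt_const hx, self_mem_nhdsWithin]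
          with S hS hSE
        exact ⟨hSE, x, hS⟩
      · intro T hT
        refine Metric.mem_closure_iff.2 fun ε hε => ?_
        obtain ⟨S, hS, hST, x, rfl⟩ := h T hT e ε hε
        refine ⟨S, ⟨hS, x, ?_⟩, by rwa [dist_comm, dist_eq_norm]⟩
        simpa using Nat.one_div_pos_of_nat (α := ℝ)
    exact mem_of_superset hW fun T hT => hT.2
  obtain ⟨d, hd⟩ := TopologicalSpace.exists_dense_seq H
  filter_upwards [eventually_countable_forall.2 fun m : ℕ =>
    eventually_countable_forall.2 fun n : ℕ => key (d m) n] with T hT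
  refine dense_closure.1 (hd.mono ?_)
  rintro _ ⟨m, rfl⟩
  refine Metric.mem_closure_iff.2 fun ε hε => ?_
  obtain ⟨n, hn⟩ := exists_nat_one_div_lt hε
  obtain ⟨x, hx⟩ := hT m n
  exact ⟨_, ⟨x, rfl⟩, by rw [dist_comm, dist_eq_norm]; exact hx.trans hn⟩

/-- The adjoint of an operator with dense range is injective. -/
theorem ker_adjoint_eq_bot_of_denseRange {A : H →L[ℂ] H} (hA : DenseRange A) :
    LinearMap.ker (adjoint A : H →ₗ[ℂ] H) = ⊥ := by
  refine LinearMap.ker_eq_bot'.2 fun y hy => ?_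
  refine Dense.eq_zero_of_inner_left ℂ hA ?_
  rintro _ ⟨x, rfl⟩
  rw [← adjoint_inner_left]
  simp [show adjoint A y = 0 from hy]

end GenericRange

/-! ### Generic continuous spectrum -/

open ContinuousLinearMap

/-- A spectral value `z` for which `T - z` and its adjoint have dense range belongs to the
continuous spectrum. -/
theorem mem_operatorContinuousSpectrum {H : Type*} [NormedAddCommGroup H] [InnerProductSpace ℂ H]
    [CompleteSpace H] {T : H →L[ℂ] H} {z : ℂ} (hz : z ∈ spectrum ℂ T)
    (h : DenseRange (T - z • ContinuousLinearMap.id ℂ H))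
    (h' : DenseRange (adjoint (T - z • ContinuousLinearMap.id ℂ H))) :
    z ∈ operatorContinuousSpectrum T := by
  refine ⟨hz, ?_⟩
  rintro (hp | ⟨w, hw, rfl⟩)
  · have := ker_adjoint_eq_bot_of_denseRange h'
    rw [adjoint_adjoint] at this
    exact hp this
  · have := ker_adjoint_eq_bot_of_denseRange h
    rw [map_sub, LinearIsometryEquiv.map_smulₛₗ, adjoint_id] at this
    simp only [Complex.conj_conj] at this
    exact hw this

/-- Generic bounded operators have nonempty continuous spectrum. -/
theorem eventually_residual_nonempty_operatorContinuousSpectrum {H : Type*} [NormedAddCommGroup H]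
    [InnerProductSpace ℂ H] [CompleteSpace H] [TopologicalSpace.SeparableSpace H]
    (hdim : ¬ FiniteDimensional ℂ H) :
    ∀ᶠ T in residual (H →L[ℂ] H), (operatorContinuousSpectrum T).Nonempty := by
  obtain ⟨C, _, _, _, _, π, hπc, hπo, hπK⟩ := exists_calkin_quotient hdim
  obtain ⟨f, hf, D, hD, hfD⟩ := spectrum.exists_residual_continuousOn_selection C
  have hE : π ⁻¹' D ∈ residual (H →L[ℂ] H) := tendsto_residual_of_isOpenMap hπc hπo hD
  set g : (H →L[ℂ] H) → H →L[ℂ] H := fun T => T - f (π T) • ContinuousLinearMap.id ℂ H with hg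
  have hgπ : ∀ T, π (g T) = -(algebraMap ℂ C (f (π T)) - π T) := fun T => by
    change π (T - f (π T) • (1 : H →L[ℂ] H)) = _
    rw [map_sub, map_smul, map_one, Algebra.algebraMap_eq_smul_one, neg_sub]
  have hgK : ∀ T K : H →L[ℂ] H, IsCompactOperator K → π (T + K) = π T ∧ g (T + K) = g T + K := by
    intro T K hK
    have : π (T + K) = π T := by rw [map_add, hπK K hK, add_zero]
    exact ⟨this, by simp only [hg, this]; abel⟩
  have hleft : ∀ T B, B * g T ≠ 1 := fun T B h => by
    have := congrArg π h
    rw [map_mul, hgπ, mul_neg, ← neg_mul, map_one] at this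
    exact (spectrum.no_one_sided_inverse_of_mem_frontier (hf (π T))).1 this
  have hright : ∀ T B, g T * B ≠ 1 := fun T B h => by
    have := congrArg π h
    rw [map_mul, hgπ, neg_mul, ← mul_neg, map_one] at this
    exact (spectrum.no_one_sided_inverse_of_mem_frontier (hf (π T))).2 this
  have hright' : ∀ T B, B * adjoint (g T) ≠ 1 := fun T B h => hright T (adjoint B) <| by
    have := congrArg star h
    rwa [star_mul, star_one, star_eq_adjoint, star_eq_adjoint, adjoint_adjoint] at this
  have hgc : ContinuousOn g (π ⁻¹' D) :=
    continuousOn_id.sub ((hfD.comp hπc.continuousOn (mapsTo_preimage π D)).smul continuousOn_const)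
  have hdense := eventually_residual_denseRange hE hgc fun T hT e ε hε => by
    obtain ⟨K, hK, -, hKε, x, hx⟩ := exists_compact_perturbation_mem_range
      (fun _ => exists_norm_apply_lt_of_no_left_inverse (hleft T)) e hε
    obtain ⟨h1, h2⟩ := hgK T K hK
    exact ⟨T + K, by rwa [mem_preimage, h1], by simpa using hKε, x, by rw [h2, hx]⟩
  have hdense' := eventually_residual_denseRange hE
    ((adjoint (𝕜 := ℂ) (E := H) (F := H)).continuous.comp_continuousOn hgc) fun T hT e ε hε => by
    obtain ⟨K, -, hK, hKε, x, hx⟩ := exists_compact_perturbation_mem_range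
      (fun _ => exists_norm_apply_lt_of_no_left_inverse (hright' T)) e hε
    -- `K` perturbs the adjoint of `g T`, so `T` itself moves by `adjoint K`, which must be compact.
    obtain ⟨h1, h2⟩ := hgK T (adjoint K) hK
    refine ⟨T + adjoint K, by rwa [mem_preimage, h1], by simpa using hKε, x, ?_⟩
    rw [Function.comp_apply, h2, map_add, adjoint_adjoint, hx]
  filter_upwards [hdense, hdense'] with T hT hT'
  refine ⟨f (π T), mem_operatorContinuousSpectrum ?_ hT hT'⟩
  exact AlgHom.spectrum_apply_subset π T ((spectrum.isClosed _).frontier_subset (hf _))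

end Genericity

/-- `residual` is the filter of co-meager sets; `H →L[ℂ] H` carries the operator norm topology. -/
theorem theorem2 {H : Type*} [NormedAddCommGroup H] [InnerProductSpace ℂ H] [CompleteSpace H]
    [TopologicalSpace.SeparableSpace H] (hdim : ¬ FiniteDimensional ℂ H) :
    {T : H →L[ℂ] H | (operatorContinuousSpectrum T).Nonempty} ∈ residual (H →L[ℂ] H) ∧
    IsMeagre {T : H →L[ℂ] H | operatorContinuousSpectrum T = ∅} ∧
    {T : H →L[ℂ] H | operatorContinuousSpectrum T = ∅} ∉ residual (H →L[ℂ] H) := by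
  have h := eventually_residual_nonempty_operatorContinuousSpectrum hdim
  refine ⟨h, ?_, fun hempty => ?_⟩
  · exact Filter.mem_of_superset h fun T hT => hT.ne_empty
  · obtain ⟨T, hT, hT'⟩ := (dense_of_mem_residual (Filter.inter_mem h hempty)).nonempty
    exact hT.ne_empty hT'
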